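/- Let $\mathcal{A}$ be a (strict) $2$-category with finite weighted bilimits, and let $P:\mathcal{A}\to\mathcal{C}at$ be a (strict) $2$-functor into the $2$-category of small categories. If $P$ is left exact, then its $2$-category of elements $\mathcal{E}l_P$ is $\sigma$-cofiltered with respect to the family $\mathcal{C}art_P$ of cocartesian arrows. The notions used are the following. **Bilimits.** For $2$-functors $W:\mathcal{D}\to\mathcal{C}at$ and $F:\mathcal{D}\to\mathcal{B}$ and an object $E$ of $\mathcal{B}$, let $\mathrm{Cones}^W(E,F)$ be the category of pseudonatural transformations $W\Rightarrow\mathcal{B}(E,F-)$ and modifications. A bilimit of $F$ weighted by $W$ is an object $L$ with a cone $\xi\in\mathrm{Cones}^W(L,F)$ such that, for every object $B$, the functor $\xi^*:\mathcal{B}(B,L)\to\mathrm{Cones}^W(B,F)$ is an equivalence of categories. The weight $W$ is finite if $\mathcal{D}$ has finitely many objects, arrows and $2$-cells and each category $W(d)$ has finitely many objects and arrows. $\mathcal{B}$ has finite weighted bilimits if every such $F$ has a bilimit for every finite weight $W$. **Left exactness.** A $2$-functor $H:\mathcal{B}\to\mathcal{C}$, where $\mathcal{B}$ has finite weighted bilimits,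 is left exact if it preserves them: for every finite weight $W$ and every bilimit $(L,\xi)$ of $F$ weighted by $W$, a bilimit $(L',\xi')$ of $HF$ weighted by $W$ exists and the canonical arrow $k:HL\to L'$ (determined up to isomorphism by $k^*\xi'\cong H\xi$) is an equivalence. **Elements.** The objects of $\mathcal{E}l_P$ are the pairs $(x,A)$ with $A\in\mathcal{A}$ and $x\in PA$; an arrow $(x,A)\to(y,B)$ is a pair $(f,\varphi)$ with $f:A\to B$ in $\mathcal{A}$ and $\varphi:Pf(x)\to y$ in $PB$; a $2$-cell $(f,\varphi)\Rightarrow(g,\psi)$ is a $2$-cell $\theta:f\Rightarrow g$ of $\mathcal{A}$ with $\psi\circ(P\theta)_x=\varphi$; $(g,\psi)(f,\varphi)=(gf,\psi\circ Pg(\varphi))$, and $2$-cells are composed as in $\mathcal{A}$. $\mathcal{C}art_P$ consists of the arrows $(f,\varphi)$ with $\varphi$ invertible. **$\sigma$-cofiltered.** Let $\Sigma$ be a family of arrows of a $2$-category $\mathcal{C}$ which contains the identities and is closed under composition. $\mathcal{C}$ is $\sigma$-cofiltered with respect to $\Sigma$ if it is nonempty and: - for all objects $A,B$ there are an object $E$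 and arrows $E\to A$, $E\to B$ in $\Sigma$; - for all arrows $f,g:A\to B$ with $g\in\Sigma$ there are an arrow $h:E\to A$ in $\Sigma$ and a $2$-cell $\alpha:fh\Rightarrow gh$, where $\alpha$ may be chosen invertible if $f\in\Sigma$; - for all arrows $f,g:A\to B$ with $g\in\Sigma$ and all $2$-cells $\alpha,\beta:f\Rightarrow g$ there is an arrow $h:E\to A$ in $\Sigma$ with $\alpha h=\beta h$. -/

import Mathlib

open CategoryTheory Bicategory Opposite
open scoped Pseudofunctor.StrongTrans Bicategory.Opposite

universe w₁ w₂ w v₁ v₂ v u₁ u₂ u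

namespace SigmaLim

section Sigma

/-- A wide `1`-subcategory `Σ` of a `2`-category: a family of arrows containing the identities and
closed under composition. -/
structure WideOneSubcategory (C : Type u) [Bicategory.{w, v} C] where
  mem : ∀ {a b : C}, (a ⟶ b) → Prop
  id_mem : ∀ a : C, mem (𝟙 a)
  comp_mem : ∀ {a b c : C} (f : a ⟶ b) (g : b ⟶ c), mem f → mem g → mem (f ≫ g)

/-- The same family of arrows, in the `2`-category `Cᵒᵖ` (`1`-cells reversed, `2`-cells kept). -/
def WideOneSubcategory.op {C : Type u} [Bicategory.{w, v} C] (S : WideOneSubcategory C) :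
    WideOneSubcategory Cᵒᵖ where
  mem f := S.mem f.unop
  id_mem a := S.id_mem a.unop
  comp_mem f g hf hg := S.comp_mem g.unop f.unop hg hf

/-- The pair `(C, Σ)` is `σ`-filtered. (Composition is written in diagrammatic order: `f ≫ h` is
`hf`, and the whiskering `α ▷ h` is `hα`.) -/
structure IsSigmaFiltered (C : Type u) [Bicategory.{w, v} C] (S : WideOneSubcategory C) :
    Prop where
  nonempty : Nonempty C
  F0 : ∀ A B : C, ∃ (E : C) (f : A ⟶ E) (g : B ⟶ E), S.mem f ∧ S.mem g
  F1 : ∀ {A B : C} (f g : A ⟶ B), S.mem g →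
    ∃ (E : C) (h : B ⟶ E) (α : f ≫ h ⟶ g ≫ h), S.mem h ∧ (S.mem f → IsIso α)
  F2 : ∀ {A B : C} {f g : A ⟶ B} (α β : f ⟶ g), S.mem g →
    ∃ (E : C) (h : B ⟶ E), S.mem h ∧ α ▷ h = β ▷ h

/-- `(C, Σ)` is `σ`-cofiltered when `(Cᵒᵖ, Σ)` is `σ`-filtered. -/
def IsSigmaCofiltered (C : Type u) [Bicategory.{w, v} C] (S : WideOneSubcategory C) : Prop :=
  IsSigmaFiltered Cᵒᵖ S.op

end Sigma

section Elements

variable {A : Type u} [Bicategory.{w, v} A]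

/-- Objects of the `2`-category of elements `El_P`: pairs `(x, A)` with `x ∈ PA`. -/
structure El (P : A ⥤ᵖ Cat.{v₂, u₂}) where
  base : A
  fiber : P.obj base

namespace El

variable {P : A ⥤ᵖ Cat.{v₂, u₂}}

/-- Arrows `(x, A) ⟶ (y, B)` of `El_P`: pairs `(f, φ)` with `f : A ⟶ B` and `φ : Pf(x) ⟶ y`. -/
structure Hom (X Y : El P) where
  base : X.base ⟶ Y.base
  fiber : (P.map base).toFunctor.obj X.fiber ⟶ Y.fiber

/-- `(g, ψ)(f, φ) = (gf, ψ ∘ Pg(φ))`, up to the structural isomorphisms of `P`, which are identities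
when `P` is a `2`-functor. -/
instance : CategoryStruct (El P) where
  Hom X Y := Hom X Y
  id X :=
    { base := 𝟙 X.base
      fiber := (P.mapId X.base).hom.toNatTrans.app X.fiber }
  comp {X _ _} f g :=
    { base := f.base ≫ g.base
      fiber := (P.mapComp f.base g.base).hom.toNatTrans.app X.fiber ≫
        (P.map g.base).toFunctor.map f.fiber ≫ g.fiber }

@[simp] lemma id_base (X : El P) : Hom.base (𝟙 X : X ⟶ X) = 𝟙 X.base := rfl

@[simp] lemma id_fiber (X : El P) :
    Hom.fiber (𝟙 X : X ⟶ X) = (P.mapId X.base).hom.toNatTrans.app X.fiber := rfl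

@[simp] lemma comp_base {X Y Z : El P} (f : X ⟶ Y) (g : Y ⟶ Z) :
    Hom.base (f ≫ g) = Hom.base f ≫ Hom.base g := rfl

@[simp] lemma comp_fiber {X Y Z : El P} (f : X ⟶ Y) (g : Y ⟶ Z) :
    Hom.fiber (f ≫ g) = (P.mapComp (Hom.base f) (Hom.base g)).hom.toNatTrans.app X.fiber ≫
        (P.map (Hom.base g)).toFunctor.map (Hom.fiber f) ≫ Hom.fiber g := rfl

/-- `2`-cells `(f, φ) ⟶ (g, ψ)` of `El_P`: `2`-cells `θ : f ⟶ g` of the base such that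
`ψ ∘ (Pθ)_x = φ`. -/
@[ext]
structure Hom₂ {X Y : El P} (f g : X ⟶ Y) where
  base : Hom.base f ⟶ Hom.base g
  w : (P.map₂ base).toNatTrans.app X.fiber ≫ Hom.fiber g = Hom.fiber f

@[simps]
instance homCategory (X Y : El P) : Category (X ⟶ Y) where
  Hom f g := Hom₂ f g
  id f := { base := 𝟙 (Hom.base f), w := by simp }
  comp η θ := { base := η.base ≫ θ.base, w := by simp [η.w, θ.w] }
  id_comp _ := Hom₂.ext (Category.id_comp _)
  comp_id _ := Hom₂.ext (Category.comp_id _)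
  assoc _ _ _ := Hom₂.ext (Category.assoc _ _ _)

lemma hom₂_ext {X Y : El P} {f g : X ⟶ Y} {η θ : f ⟶ g}
    (h : Hom₂.base η = Hom₂.base θ) : η = θ := Hom₂.ext h

/-- An invertible `2`-cell of the base which is a `2`-cell of `El_P` is invertible in `El_P`. -/
def isoMk {X Y : El P} {f g : X ⟶ Y} (e : Hom.base f ≅ Hom.base g)
    (w : (P.map₂ e.hom).toNatTrans.app X.fiber ≫ Hom.fiber g = Hom.fiber f) : f ≅ g where
  hom := Hom₂.mk e.hom w
  inv := Hom₂.mk e.inv (by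
    rw [← w, ← Category.assoc, ← Cat.Hom₂.comp_app, ← P.map₂_comp]; simp)
  hom_inv_id := Hom₂.ext e.hom_inv_id
  inv_hom_id := Hom₂.ext e.inv_hom_id

lemma whiskerLeft_w {X Y Z : El P} (f : X ⟶ Y) {g h : Y ⟶ Z} (η : g ⟶ h) :
    (P.map₂ (Hom.base f ◁ Hom₂.base η)).toNatTrans.app X.fiber ≫ Hom.fiber (f ≫ h) =
      Hom.fiber (f ≫ g) := by
  have hw := Hom₂.w η
  have hn := (P.map₂ (Hom₂.base η)).toNatTrans.naturality (Hom.fiber f)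
  simp only [comp_fiber, P.map₂_whisker_left, Cat.Hom₂.comp_app, Cat.whiskerLeft_app,
    Category.assoc, Cat.Hom.inv_hom_id_toNatTrans_app_assoc, ← hw]
  rw [← reassoc_of% hn]

lemma whiskerRight_w {X Y Z : El P} {f g : X ⟶ Y} (η : f ⟶ g) (h : Y ⟶ Z) :
    (P.map₂ (Hom₂.base η ▷ Hom.base h)).toNatTrans.app X.fiber ≫ Hom.fiber (g ≫ h) =
      Hom.fiber (f ≫ h) := by
  have hw := Hom₂.w η
  simp only [comp_fiber, P.map₂_whisker_right, Cat.Hom₂.comp_app, Cat.whiskerRight_app,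
    Category.assoc, Cat.Hom.inv_hom_id_toNatTrans_app_assoc, ← hw, Functor.map_comp]

lemma associator_w {X Y Z W : El P} (f : X ⟶ Y) (g : Y ⟶ Z) (h : Z ⟶ W) :
    (P.map₂ (α_ (Hom.base f) (Hom.base g) (Hom.base h)).hom).toNatTrans.app X.fiber ≫
      Hom.fiber (f ≫ g ≫ h) = Hom.fiber ((f ≫ g) ≫ h) := by
  have hn := (P.mapComp (Hom.base g) (Hom.base h)).inv.toNatTrans.naturality (Hom.fiber f)
  simp only [comp_fiber, comp_base, P.map₂_associator, Cat.Hom₂.comp_app, Cat.whiskerLeft_app,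
    Cat.whiskerRight_app, Category.assoc, Cat.Hom.inv_hom_id_toNatTrans_app_assoc,
    Functor.map_comp]
  have hn' : (P.map (Hom.base h)).toFunctor.map ((P.map (Hom.base g)).toFunctor.map
        (Hom.fiber f)) ≫ (P.mapComp (Hom.base g) (Hom.base h)).inv.toNatTrans.app Y.fiber =
      (P.mapComp (Hom.base g) (Hom.base h)).inv.toNatTrans.app
        ((P.map (Hom.base f)).toFunctor.obj X.fiber) ≫
        (P.map (Hom.base g ≫ Hom.base h)).toFunctor.map (Hom.fiber f) := hn
  rw [← reassoc_of% hn', Cat.Hom.inv_hom_id_toNatTrans_app_assoc]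
  simp

lemma leftUnitor_w {X Y : El P} (f : X ⟶ Y) :
    (P.map₂ (λ_ (Hom.base f)).hom).toNatTrans.app X.fiber ≫ Hom.fiber f =
      Hom.fiber (𝟙 X ≫ f) := by
  simp only [comp_fiber, id_fiber, id_base, P.map₂_left_unitor, Cat.Hom₂.comp_app,
    Cat.whiskerRight_app, Category.assoc, Cat.leftUnitor_hom_app, eqToHom_refl, Category.id_comp]

lemma rightUnitor_w {X Y : El P} (f : X ⟶ Y) :
    (P.map₂ (ρ_ (Hom.base f)).hom).toNatTrans.app X.fiber ≫ Hom.fiber f =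
      Hom.fiber (f ≫ 𝟙 Y) := by
  have hn := (P.mapId Y.base).hom.toNatTrans.naturality (Hom.fiber f)
  simp only [comp_fiber, id_fiber, id_base, P.map₂_right_unitor, Cat.Hom₂.comp_app,
    Cat.whiskerLeft_app, Category.assoc, Cat.rightUnitor_hom_app, eqToHom_refl, Category.id_comp]
  have hn' : (P.map (𝟙 Y.base)).toFunctor.map (Hom.fiber f) ≫
      (P.mapId Y.base).hom.toNatTrans.app Y.fiber =
      (P.mapId Y.base).hom.toNatTrans.app ((P.map (Hom.base f)).toFunctor.obj X.fiber) ≫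
        Hom.fiber f := hn
  rw [hn']

/-- The `2`-category of elements of `P`; all compositions of `2`-cells are computed in the base. -/
instance : Bicategory (El P) where
  whiskerLeft {X Y Z} f {g h} η := Hom₂.mk (Hom.base f ◁ Hom₂.base η) (whiskerLeft_w f η)
  whiskerRight {X Y Z} {f g} η h := Hom₂.mk (Hom₂.base η ▷ Hom.base h) (whiskerRight_w η h)
  associator f g h := isoMk (α_ (Hom.base f) (Hom.base g) (Hom.base h)) (associator_w f g h)
  leftUnitor f := isoMk (λ_ (Hom.base f)) (leftUnitor_w f)
  rightUnitor f := isoMk (ρ_ (Hom.base f)) (rightUnitor_w f)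
  whiskerLeft_id _ _ := hom₂_ext (whiskerLeft_id _ _)
  whiskerLeft_comp _ _ _ _ _ _ := hom₂_ext (whiskerLeft_comp _ _ _)
  id_whiskerLeft _ := hom₂_ext (id_whiskerLeft _)
  comp_whiskerLeft _ _ _ _ _ := hom₂_ext (comp_whiskerLeft _ _ _)
  id_whiskerRight _ _ := hom₂_ext (id_whiskerRight _ _)
  comp_whiskerRight _ _ _ := hom₂_ext (comp_whiskerRight _ _ _)
  whiskerRight_id _ := hom₂_ext (whiskerRight_id _)
  whiskerRight_comp _ _ _ := hom₂_ext (whiskerRight_comp _ _ _)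
  whisker_assoc _ _ _ _ _ := hom₂_ext (whisker_assoc _ _ _)
  whisker_exchange _ _ := hom₂_ext (whisker_exchange _ _)
  pentagon _ _ _ _ := hom₂_ext (pentagon _ _ _ _)
  triangle _ _ := hom₂_ext (triangle _ _)

lemma hom_ext_of_eqToHom {X Y : El P} {f g : X ⟶ Y} (h : Hom.base f = Hom.base g)
    (h' : (P.map₂ (eqToHom h)).toNatTrans.app X.fiber ≫ Hom.fiber g = Hom.fiber f) : f = g := by
  obtain ⟨fb, ff⟩ := f
  obtain ⟨gb, gf⟩ := g
  dsimp at h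
  subst h
  simp at h'
  rw [h']

lemma eqToHom_base {X Y : El P} {f g : X ⟶ Y} (h : f = g) :
    Hom₂.base (eqToHom h) = eqToHom (congrArg Hom.base h) := by
  subst h
  rfl

/-- Over a (strict) `2`-category, `El_P` is a (strict) `2`-category. -/
instance [Bicategory.Strict A] : Bicategory.Strict (El P) where
  id_comp f := hom_ext_of_eqToHom (Bicategory.Strict.id_comp _) (by
    have := leftUnitor_w f
    rw [Bicategory.Strict.leftUnitor_eqToIso] at this
    exact this)
  comp_id f := hom_ext_of_eqToHom (Bicategory.Strict.comp_id _) (by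
    have := rightUnitor_w f
    rw [Bicategory.Strict.rightUnitor_eqToIso] at this
    exact this)
  assoc f g h := hom_ext_of_eqToHom (Bicategory.Strict.assoc _ _ _) (by
    have := associator_w f g h
    rw [Bicategory.Strict.associator_eqToIso] at this
    exact this)
  leftUnitor_eqToIso f := by
    ext
    apply hom₂_ext
    rw [eqToIso.hom, eqToHom_base]
    exact congrArg Iso.hom (Bicategory.Strict.leftUnitor_eqToIso _)
  rightUnitor_eqToIso f := by
    ext
    apply hom₂_ext
    rw [eqToIso.hom, eqToHom_base]
    exact congrArg Iso.hom (Bicategory.Strict.rightUnitor_eqToIso _)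
  associator_eqToIso f g h := by
    ext
    apply hom₂_ext
    rw [eqToIso.hom, eqToHom_base]
    exact congrArg Iso.hom (Bicategory.Strict.associator_eqToIso _ _ _)

/-- The family `Cart_P` of cocartesian arrows of `El_P`: the `(f, φ)` with `φ` invertible. -/
def cart (P : A ⥤ᵖ Cat.{v₂, u₂}) : WideOneSubcategory (El P) where
  mem f := IsIso (Hom.fiber f)
  id_mem X := by
    rw [id_fiber]
    exact inferInstanceAs (IsIso ((Cat.Hom.toNatIso (P.mapId X.base)).hom.app X.fiber))
  comp_mem {X Y Z} f g hf hg := by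
    rw [comp_fiber]
    have : IsIso ((P.mapComp (Hom.base f) (Hom.base g)).hom.toNatTrans.app X.fiber) :=
      inferInstanceAs (IsIso ((Cat.Hom.toNatIso
        (P.mapComp (Hom.base f) (Hom.base g))).hom.app X.fiber))
    infer_instance

end El

end Elements

section Bilimits

variable {C : Type u} [Bicategory.{w, v} C]

/-- The covariant representable `C(E, -) : C ⥤ Cat`. -/
def rep (E : C) : C ⥤ᵖ Cat.{w, v} where
  obj b := Cat.of (E ⟶ b)
  map f := (postcomposingCat E _ _).obj f
  map₂ η := (postcomposingCat E _ _).map η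
  map₂_id _ := (postcomposingCat E _ _).map_id _
  map₂_comp _ _ := (postcomposingCat E _ _).map_comp _ _
  mapId b := rightUnitorNatIsoCat E b
  mapComp f g := (associatorNatIsoLeftCat E f g).symm
  map₂_whisker_left {a b c} f g h η := by
    ext (x : E ⟶ a)
    change x ◁ f ◁ η = (α_ x f g).inv ≫ (x ≫ f) ◁ η ≫ (α_ x f h).hom
    simp
  map₂_whisker_right {a b c} f g η h := by
    ext (x : E ⟶ a)
    change x ◁ η ▷ h = (α_ x f h).inv ≫ (x ◁ η) ▷ h ≫ (α_ x g h).hom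
    simp
  map₂_associator {a b c d} f g h := by
    ext (x : E ⟶ a)
    change x ◁ (α_ f g h).hom = (α_ x (f ≫ g) h).inv ≫ (α_ x f g).inv ▷ h ≫
      𝟙 (((x ≫ f) ≫ g) ≫ h) ≫ (α_ (x ≫ f) g h).hom ≫ (α_ x f (g ≫ h)).hom
    simp
  map₂_left_unitor {a b} f := by
    ext (x : E ⟶ a)
    change x ◁ (λ_ f).hom = (α_ x (𝟙 a) f).inv ≫ (ρ_ x).hom ▷ f ≫ 𝟙 (x ≫ f)
    simp
  map₂_right_unitor {a b} f := by
    ext (x : E ⟶ a)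
    change x ◁ (ρ_ f).hom = (α_ x f (𝟙 b)).inv ≫ (ρ_ (x ≫ f)).hom ≫ 𝟙 (x ≫ f)
    simp

variable {D : Type u₁} [Bicategory.{w₁, v₁} D]

/-- Precomposition with `f : B ⟶ E`, as a pseudonatural transformation
`C(E, F-) ⟶ C(B, F-)`. -/
def repPrecomp (F : D ⥤ᵖ C) {B E : C} (f : B ⟶ E) : F.comp (rep E) ⟶ F.comp (rep B) where
  app d := (precomposingCat B E (F.obj d)).obj f
  naturality {d e} t := (associatorNatIsoMiddleCat f (F.map t)).symm
  naturality_naturality {d e} s t η := by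
    ext (x : E ⟶ F.obj d)
    change f ◁ x ◁ F.map₂ η ≫ (α_ f x (F.map t)).inv =
      (α_ f x (F.map s)).inv ≫ (f ≫ x) ◁ F.map₂ η
    simp
  naturality_id d := by
    ext (x : E ⟶ F.obj d)
    change (α_ f x (F.map (𝟙 d))).inv ≫ (f ≫ x) ◁ (F.mapId d).hom ≫ (ρ_ (f ≫ x)).hom =
      f ◁ (x ◁ (F.mapId d).hom ≫ (ρ_ x).hom) ≫ 𝟙 (f ≫ x) ≫ 𝟙 (f ≫ x)
    simp
  naturality_comp {a b c} s t := by
    ext (x : E ⟶ F.obj a)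
    change (α_ f x (F.map (s ≫ t))).inv ≫ (f ≫ x) ◁ (F.mapComp s t).hom ≫
        (α_ (f ≫ x) (F.map s) (F.map t)).inv =
      f ◁ (x ◁ (F.mapComp s t).hom ≫ (α_ x (F.map s) (F.map t)).inv) ≫ 𝟙 _ ≫
        (α_ f (x ≫ F.map s) (F.map t)).inv ≫ 𝟙 _ ≫ (α_ f x (F.map s)).inv ▷ F.map t ≫ 𝟙 _
    simp

/-- The functor `C(B, E) ⥤ Hom_p(D, Cat)(C(E, F-), C(B, F-))`, `f ↦ f^*`, `α ↦ α^*`. -/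
def repPrecomposing (F : D ⥤ᵖ C) (B E : C) : (B ⟶ E) ⥤ (F.comp (rep E) ⟶ F.comp (rep B)) where
  obj f := repPrecomp F f
  map {f g} α :=
    { as :=
      { app := fun d => (precomposingCat B E (F.obj d)).map α
        naturality := fun {d e} t => by
          ext (x : E ⟶ F.obj d)
          change α ▷ (x ≫ F.map t) ≫ (α_ g x (F.map t)).inv =
            (α_ f x (F.map t)).inv ≫ (α ▷ x) ▷ F.map t
          simp } }
  map_id f := by
    apply Pseudofunctor.StrongTrans.homCategory.ext
    exact fun d => (precomposingCat B E (F.obj d)).map_id f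
  map_comp α β := by
    apply Pseudofunctor.StrongTrans.homCategory.ext
    exact fun d => (precomposingCat B E (F.obj d)).map_comp α β

/-- The category `Cones_p^W(E, F) = Hom_p(D, Cat)(W, C(E, F-))` of pseudocones for `F` with respect
to the weight `W`, with vertex `E`: its objects are the pseudonatural transformations and its
arrows are the modifications. -/
abbrev WCone (W : D ⥤ᵖ Cat.{w, v}) (F : D ⥤ᵖ C) (E : C) := W ⟶ F.comp (rep E)

/-- `ξ^* : C(B, E) ⥤ Cones_p^W(B, F)`. -/
def WCone.pullback {W : D ⥤ᵖ Cat.{w, v}} {F : D ⥤ᵖ C} {E : C} (ξ : WCone W F E) (B : C) :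
    (B ⟶ E) ⥤ WCone W F B :=
  repPrecomposing F B E ⋙ Bicategory.precomp (F.comp (rep B)) ξ

/-- The pseudocone `ξ` exhibits its vertex as the bilimit of `F` weighted by `W`. -/
def IsBilimit {W : D ⥤ᵖ Cat.{w, v}} {F : D ⥤ᵖ C} {L : C} (ξ : WCone W F L) : Prop :=
  ∀ B : C, (ξ.pullback B).IsEquivalence

/-- The arrow `f` is an equivalence in the `2`-category `C`. -/
def IsEquivalenceArrow {a b : C} (f : a ⟶ b) : Prop :=
  ∃ g : b ⟶ a, Nonempty (f ≫ g ≅ 𝟙 a) ∧ Nonempty (g ≫ f ≅ 𝟙 b)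

variable {C' : Type u₂} [Bicategory.{w, v} C']

/-- The pseudonatural transformation `C(E, F-) ⟶ C'(HE, HF-)` given by the action of `H` on
hom-categories. -/
def repMap (F : D ⥤ᵖ C) (H : C ⥤ᵖ C') (E : C) :
    F.comp (rep E) ⟶ (F.comp H).comp (rep (H.obj E)) where
  app d := (H.mapFunctor E (F.obj d)).toCatHom
  naturality {d e} t := Cat.Hom.isoMk (NatIso.ofComponents
    (F := (postcomp E (F.map t)) ⋙ H.mapFunctor E (F.obj e))
    (G := H.mapFunctor E (F.obj d) ⋙ postcomp (H.obj E) (H.map (F.map t)))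
    (fun x => H.mapComp x (F.map t)) (by
      intro x y η
      change H.map₂ (η ▷ F.map t) ≫ (H.mapComp y (F.map t)).hom =
        (H.mapComp x (F.map t)).hom ≫ H.map₂ η ▷ H.map (F.map t)
      simp))
  naturality_naturality {d e} s t η := by
    ext (x : E ⟶ F.obj d)
    change H.map₂ (x ◁ F.map₂ η) ≫ (H.mapComp x (F.map t)).hom =
      (H.mapComp x (F.map s)).hom ≫ H.map x ◁ H.map₂ (F.map₂ η)
    simp
  naturality_id d := by
    ext (x : E ⟶ F.obj d)
    change (H.mapComp x (F.map (𝟙 d))).hom ≫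
        H.map x ◁ (H.map₂ (F.mapId d).hom ≫ (H.mapId (F.obj d)).hom) ≫ (ρ_ (H.map x)).hom =
      H.map₂ (x ◁ (F.mapId d).hom ≫ (ρ_ x).hom) ≫ 𝟙 (H.map x) ≫ 𝟙 (H.map x)
    simp
  naturality_comp {a b c} s t := by
    ext (x : E ⟶ F.obj a)
    change (H.mapComp x (F.map (s ≫ t))).hom ≫
        H.map x ◁ (H.map₂ (F.mapComp s t).hom ≫ (H.mapComp (F.map s) (F.map t)).hom) ≫
        (α_ (H.map x) (H.map (F.map s)) (H.map (F.map t))).inv =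
      H.map₂ (x ◁ (F.mapComp s t).hom ≫ (α_ x (F.map s) (F.map t)).inv) ≫ 𝟙 _ ≫
        (H.mapComp (x ≫ F.map s) (F.map t)).hom ≫ 𝟙 _ ≫
        (H.mapComp x (F.map s)).hom ▷ H.map (F.map t) ≫ 𝟙 _
    have h := H.mapComp_assoc_right_hom x (F.map s) (F.map t) =≫
      (α_ (H.map x) (H.map (F.map s)) (H.map (F.map t))).inv
    simp only [Category.assoc, Iso.hom_inv_id, Category.comp_id] at h
    simp [← h]

/-- The image `Hξ` of a pseudocone under `H`. -/
def WCone.image {W : D ⥤ᵖ Cat.{w, v}} {F : D ⥤ᵖ C} {E : C} (ξ : WCone W F E) (H : C ⥤ᵖ C') :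
    WCone W (F.comp H) (H.obj E) :=
  ξ ≫ repMap F H E

/-- `H` preserves the bilimit `(L, ξ)` of `F` weighted by `W`: a bilimit `(L', ξ')` of `HF` weighted
by `W` exists, and the canonical arrow `k : HL ⟶ L'` (the one with `k^* ξ' ≅ Hξ`, unique up to
isomorphism) is an equivalence. -/
def PreservesBilimit (H : C ⥤ᵖ C') {W : D ⥤ᵖ Cat.{w, v}} {F : D ⥤ᵖ C} {L : C}
    (ξ : WCone W F L) : Prop :=
  ∃ (L' : C') (ξ' : WCone W (F.comp H) L'), IsBilimit ξ' ∧
    ∃ k : H.obj L ⟶ L', Nonempty ((ξ'.pullback (H.obj L)).obj k ≅ ξ.image H) ∧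
      IsEquivalenceArrow k

/-- Finitely many objects, arrows and `2`-cells. -/
def IsFiniteTwoCategory (D : Type u) [Bicategory.{w, v} D] : Prop :=
  Finite D ∧ (∀ a b : D, Finite (a ⟶ b)) ∧ ∀ (a b : D) (f g : a ⟶ b), Finite (f ⟶ g)

/-- Finitely many objects and arrows. -/
def IsFiniteCategory (K : Type u) [Category.{v} K] : Prop :=
  Finite K ∧ ∀ x y : K, Finite (x ⟶ y)

/-- `W : D ⥤ Cat` is a finite weight. -/
def IsFiniteWeight (W : StrictPseudofunctor D Cat.{w, v}) : Prop :=
  IsFiniteTwoCategory D ∧ ∀ d : D, IsFiniteCategory (W.obj d)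

end Bilimits

section Exact

/-- The `2`-category `C` has finite weighted bilimits. (`2`-functors are the strict
pseudofunctors. Every finite `2`-category is isomorphic to one in the lowest universe, so it
suffices to consider those as domains of weights.) -/
def HasFiniteBilimits (C : Type u) [Bicategory.{v, v} C] : Prop :=
  ∀ (D : Type) [Bicategory.{0, 0} D] [Bicategory.Strict D]
    (W : StrictPseudofunctor D Cat.{v, v}) (F : StrictPseudofunctor D C), IsFiniteWeight W →
    ∃ (L : C) (ξ : WCone W.toPseudofunctor F.toPseudofunctor L), IsBilimit ξ

/-- The `2`-functor `H` preserves all finite weighted bilimits. -/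
def IsLeftExact {C : Type u₁} [Bicategory.{v, v} C] {C' : Type u₂} [Bicategory.{v, v} C']
    (H : StrictPseudofunctor C C') : Prop :=
  ∀ (D : Type) [Bicategory.{0, 0} D] [Bicategory.Strict D]
    (W : StrictPseudofunctor D Cat.{v, v}) (F : StrictPseudofunctor D C), IsFiniteWeight W →
    ∀ (L : C) (ξ : WCone W.toPseudofunctor F.toPseudofunctor L), IsBilimit ξ →
      PreservesBilimit H.toPseudofunctor ξ

end Exact

end SigmaLim

/-! Each clause of `σ`-cofilteredness asks for data in `A` lifting data already present in the
fibres of `P`, and left exactness supplies the lift. Let `(L, ξ)` be a finite bilimit of `F` in `A`.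
Since `PL` is equivalent, compatibly with `Pξ`, to a bilimit of `PF`, every pseudocone on `PF` with
vertex `T` is isomorphic to `z^*(Pξ)` for some `z : T ⟶ PL` (`IsLeftExact.exists_cone`). For `T` the
terminal category, `z` is an element of `PL`, and a projection `h : L ⟶ X` with its comparison
isomorphism `Ph(z) ≅ x` is a cocartesian arrow `(z, L) ⟶ (x, X)`.

It remains to choose the bilimits. A biterminal object gives nonemptiness and a binary product gives
`F0`. For `(f, φ)` and `(g, ψ)` with `ψ` invertible, the arrow `ψ⁻¹φ : Pf(x) ⟶ Pg(x)` places `x` in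
the inserter of `Pf` and `Pg`, or in the iso-inserter if `φ` is invertible too; this gives `F1`. For
`2`-cells `α, β`, cancelling `ψ` yields `(Pα)_x = (Pβ)_x`, so `x` lies in the equifier; this gives
`F2`.

All of these except the biterminal object are bilimits over the suspension of a category `K`,
weighted by a functor `G : K ⥤ V`: for `H : K ⥤ A(X, Y)`, a pseudocone is `h : L ⟶ X` and `s : V ⥤
A(L, Y)` with `s G ≅ h ≫ H`. Hence `IsLeftExact.exists_suspension`, and its elementwise form
`IsLeftExact.exists_fiber`, treat them uniformly. -/

namespace SigmaLim

/-! ### Pseudocones in components -/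

section Cones

variable {C : Type u} [Bicategory.{w, v} C] {D : Type u₁} [Bicategory.{w₁, v₁} D]
  {W : D ⥤ᵖ Cat.{w, v}} {F : D ⥤ᵖ C} {E : C}

/-- The component at `d` of a pseudocone. -/
def WCone.leg (ξ : WCone W F E) (d : D) : W.obj d ⥤ (E ⟶ F.obj d) :=
  (ξ.app d).toFunctor

/-- The structural isomorphism of a pseudocone at an arrow `t` of the diagram. -/
def WCone.legIso (ξ : WCone W F E) {d e : D} (t : d ⟶ e) (x : W.obj d) :
    (ξ.leg e).obj ((W.map t).toFunctor.obj x) ≅ (ξ.leg d).obj x ≫ F.map t :=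
  (Cat.Hom.toNatIso (ξ.naturality t)).app x

lemma WCone.legIso_naturality₂ (ξ : WCone W F E) {d e : D} {s t : d ⟶ e} (η : s ⟶ t)
    (x : W.obj d) :
    (ξ.leg e).map ((W.map₂ η).toNatTrans.app x) ≫ (ξ.legIso t x).hom =
      (ξ.legIso s x).hom ≫ (ξ.leg d).obj x ◁ F.map₂ η :=
  congrArg (fun α => α.toNatTrans.app x) (ξ.naturality_naturality η)

/-- The isomorphisms between the components of isomorphic pseudocones. -/
def WCone.isoLeg {ξ ζ : WCone W F E} (i : ξ ≅ ζ) (d : D) : ξ.leg d ≅ ζ.leg d where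
  hom := (i.hom.as.app d).toNatTrans
  inv := (i.inv.as.app d).toNatTrans
  hom_inv_id := congrArg (fun α => (α.as.app d).toNatTrans) i.hom_inv_id
  inv_hom_id := congrArg (fun α => (α.as.app d).toNatTrans) i.inv_hom_id

lemma WCone.isoLeg_naturality {ξ ζ : WCone W F E} (i : ξ ≅ ζ) {d e : D} (t : d ⟶ e)
    (x : W.obj d) :
    (isoLeg i e).hom.app ((W.map t).toFunctor.obj x) ≫ (ζ.legIso t x).hom =
      (ξ.legIso t x).hom ≫ (isoLeg i d).hom.app x ▷ F.map t :=
  congrArg (fun α => α.toNatTrans.app x) (i.hom.as.naturality t)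

/-- The naturality isomorphism of a composite transformation into `Cat` is pasted from two
whiskerings and three associators. The latter have identity components, so up to unfolding the
composite has this shape. -/
lemma comp_with_identities {K : Type u} [Category.{v} K] {a b c : K} (f : a ⟶ b) (g : b ⟶ c) :
    𝟙 a ≫ f ≫ 𝟙 b ≫ g ≫ 𝟙 c = f ≫ g := by
  simp

lemma WCone.pullback_legIso_hom (ξ : WCone W F E) {B : C} (k : B ⟶ E) {d e : D} (t : d ⟶ e)
    (x : W.obj d) :
    (WCone.legIso ((ξ.pullback B).obj k) t x).hom =
      k ◁ (ξ.legIso t x).hom ≫ (α_ k ((ξ.leg d).obj x) (F.map t)).inv :=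
  comp_with_identities (k ◁ (ξ.legIso t x).hom) (α_ k ((ξ.leg d).obj x) (F.map t)).inv

lemma WCone.image_legIso_hom {C' : Type u₂} [Bicategory.{w, v} C'] (ξ : WCone W F E)
    (H : C ⥤ᵖ C') {d e : D} (t : d ⟶ e) (x : W.obj d) :
    (WCone.legIso (ξ.image H) t x).hom =
      H.map₂ (ξ.legIso t x).hom ≫ (H.mapComp ((ξ.leg d).obj x) (F.map t)).hom :=
  comp_with_identities (H.map₂ (ξ.legIso t x).hom) (H.mapComp ((ξ.leg d).obj x) (F.map t)).hom

/-- Pulling back a pseudocone along `k` and then along `z` is pulling it back along `z ≫ k`. -/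
def WCone.pullbackComp (ξ : WCone W F E) {B B' : C} (k : B ⟶ E) (z : B' ⟶ B) :
    (WCone.pullback ((ξ.pullback B).obj k) B').obj z ≅ (ξ.pullback B').obj (z ≫ k) :=
  Pseudofunctor.StrongTrans.isoMk (fun d => Cat.Hom.isoMk (NatIso.ofComponents
      (F := WCone.leg ((WCone.pullback ((ξ.pullback B).obj k) B').obj z) d)
      (G := WCone.leg ((ξ.pullback B').obj (z ≫ k)) d)
      (fun x => (α_ z k ((ξ.leg d).obj x)).symm) (fun {x y} η => by
        have h : z ◁ k ◁ (ξ.leg d).map η ≫ (α_ z k ((ξ.leg d).obj y)).inv =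
          (α_ z k ((ξ.leg d).obj x)).inv ≫ (z ≫ k) ◁ (ξ.leg d).map η := by simp
        exact h)))
    (fun {d e} t => by
      ext x
      have h : (α_ z k ((ξ.leg e).obj ((W.map t).toFunctor.obj x))).inv ≫
          (WCone.legIso ((ξ.pullback B').obj (z ≫ k)) t x).hom =
        (WCone.legIso ((WCone.pullback ((ξ.pullback B).obj k) B').obj z) t x).hom ≫
          (α_ z k ((ξ.leg d).obj x)).inv ▷ F.map t := by
        have h' : (α_ z k ((ξ.leg e).obj ((W.map t).toFunctor.obj x))).inv ≫
            (z ≫ k) ◁ (ξ.legIso t x).hom ≫ (α_ (z ≫ k) ((ξ.leg d).obj x) (F.map t)).inv =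
          (z ◁ (k ◁ (ξ.legIso t x).hom ≫ (α_ k ((ξ.leg d).obj x) (F.map t)).inv) ≫
            (α_ z (k ≫ (ξ.leg d).obj x) (F.map t)).inv) ≫
            (α_ z k ((ξ.leg d).obj x)).inv ▷ F.map t := by simp
        rw [pullback_legIso_hom, pullback_legIso_hom, pullback_legIso_hom]
        exact h'
      exact h)

end Cones

/-! ### Lifting pseudocones along a left exact functor -/

section LeftExact

/-- If `P` is left exact, then every pseudocone `τ` in `Cat` for a diagram `PF` is, up to
isomorphism, obtained by pulling back the image of a pseudocone for `F`. -/
theorem IsLeftExact.exists_cone {A : Type u} [Bicategory.{v, v} A]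
    (hA : HasFiniteBilimits A) {P : StrictPseudofunctor A Cat.{v, v}} (hP : IsLeftExact P)
    {D : Type} [Bicategory.{0, 0} D] [Bicategory.Strict D]
    (W : StrictPseudofunctor D Cat.{v, v}) (F : StrictPseudofunctor D A) (hW : IsFiniteWeight W)
    {T : Cat.{v, v}}
    (τ : WCone W.toPseudofunctor (F.toPseudofunctor.comp P.toPseudofunctor) T) :
    ∃ (L : A) (ξ : WCone W.toPseudofunctor F.toPseudofunctor L) (z : T ⟶ P.obj L),
      Nonempty ((WCone.pullback (ξ.image P.toPseudofunctor) T).obj z ≅ τ) := by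
  obtain ⟨L, ξ, hξ⟩ := hA D W F hW
  obtain ⟨L', ξ', hξ', k, ⟨e⟩, g, -, ⟨i⟩⟩ := hP D W F hW L ξ hξ
  have := hξ' T
  -- Of the universal property of `ξ'` only essential surjectivity at `T` is needed: `m^* ξ' ≅ τ`.
  let m := (ξ'.pullback T).objPreimage τ
  -- With `z = m ≫ g`: `z^*(Pξ) ≅ z^* k^* ξ' ≅ (z ≫ k)^* ξ' ≅ m^* ξ' ≅ τ`, because `g ≫ k ≅ 𝟙`.
  refine ⟨L, ξ, m ≫ g, ⟨?_ ≪≫ (ξ'.pullback T).objObjPreimageIso τ⟩⟩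
  refine (whiskerRightIso e.symm _) ≪≫ ξ'.pullbackComp k (m ≫ g) ≪≫ (ξ'.pullback T).mapIso ?_
  exact α_ _ _ _ ≪≫ whiskerLeftIso m i ≪≫ ρ_ m

end LeftExact

/-! ### The suspension of a category -/

section Suspension

/-- The suspension of a category `K`: the `2`-category with two objects, whose only nontrivial
hom-category is `K`. -/
inductive Susp (K : Type) : Type
  | src : Susp K
  | tgt : Susp K

namespace Susp

variable {K : Type}

/-- The arrows of the suspension: identities, and an arrow for every object of `K`. -/
inductive Hom : Susp K → Susp K → Type
  | id (a : Susp K) : Hom a a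
  | arr (k : K) : Hom src tgt

/-- Composition of arrows in the suspension. -/
def Hom.comp : {a b c : Susp K} → Hom a b → Hom b c → Hom a c
  | _, _, _, .id _, g => g
  | _, _, _, .arr k, .id _ => .arr k

instance : CategoryStruct (Susp K) where
  Hom := Hom
  id := Hom.id
  comp := Hom.comp

/-- The arrow of the suspension given by an object of `K`. -/
def arr (k : K) : (src : Susp K) ⟶ tgt := Hom.arr k

lemma Hom.comp_id {a b : Susp K} (f : Hom a b) : f.comp (.id b) = f := by
  cases f <;> rfl

lemma Hom.assoc {a b c d : Susp K} (f : Hom a b) (g : Hom b c) (h : Hom c d) :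
    (f.comp g).comp h = f.comp (g.comp h) := by
  cases f <;> cases g <;> cases h <;> rfl

variable [Category.{0} K]

/-- The `2`-cells of the suspension: identities, and the arrows of `K`. -/
inductive Hom₂ : {a b : Susp K} → Hom a b → Hom a b → Type
  | id (a : Susp K) : Hom₂ (.id a) (.id a)
  | arr {k l : K} (u : k ⟶ l) : Hom₂ (.arr k) (.arr l)

/-- The identity `2`-cells. -/
def Hom₂.refl : {a b : Susp K} → (f : Hom a b) → Hom₂ f f
  | _, _, .id a => .id a
  | _, _, .arr k => .arr (𝟙 k)

/-- Vertical composition of `2`-cells. -/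
def Hom₂.comp : {a b : Susp K} → {f g h : Hom a b} → Hom₂ f g → Hom₂ g h → Hom₂ f h
  | _, _, _, _, _, .id _, η => η
  | _, _, _, _, _, .arr u, .arr v => .arr (u ≫ v)

instance homCategory (a b : Susp K) : Category (a ⟶ b) where
  Hom := Hom₂
  id := Hom₂.refl
  comp := Hom₂.comp
  id_comp η := by
    cases η
    · rfl
    · exact congrArg Hom₂.arr (Category.id_comp _)
  comp_id η := by
    cases η
    · rfl
    · exact congrArg Hom₂.arr (Category.comp_id _)
  assoc η θ ι := by
    cases η
    · rfl
    · cases θ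
      cases ι
      exact congrArg Hom₂.arr (Category.assoc _ _ _)

/-- The `2`-cell of the suspension given by an arrow of `K`. -/
def arr₂ {k l : K} (u : k ⟶ l) : arr k ⟶ arr l := Hom₂.arr u

/-- Left whiskering. -/
def whiskerLeft : {a b c : Susp K} → (f : Hom a b) → {g h : Hom b c} → Hom₂ g h →
    Hom₂ (f.comp g) (f.comp h)
  | _, _, _, .id _, _, _, η => η
  | _, _, _, .arr k, _, _, .id _ => .arr (𝟙 k)

/-- Right whiskering. -/
def whiskerRight : {a b c : Susp K} → {f g : Hom a b} → Hom₂ f g → (h : Hom b c) →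
    Hom₂ (f.comp h) (g.comp h)
  | _, _, _, _, _, .id _, h => .refl h
  | _, _, _, _, _, .arr u, .id _ => .arr u

lemma Hom₂.arr_congr {k l : K} {u v : k ⟶ l} (h : u = v) : Hom₂.arr u = Hom₂.arr v :=
  congrArg Hom₂.arr h

/-- In a composable string at most one arrow is not an identity, and in each case the coherence
`eqToIso`s unfold to identities. Every axiom thus becomes trivial or an equation in `K` about
composing with identities. -/
instance : Bicategory (Susp K) where
  whiskerLeft f _ _ η := whiskerLeft f η
  whiskerRight η h := whiskerRight η h
  associator f g h := eqToIso (Hom.assoc f g h)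
  leftUnitor f := eqToIso rfl
  rightUnitor f := eqToIso (Hom.comp_id f)
  whiskerLeft_id f g := by
    change Hom _ _ at f g
    cases f <;> cases g <;> rfl
  whiskerLeft_comp f g h i η θ := by
    change Hom _ _ at f
    change Hom₂ _ _ at η θ
    cases f
    · rfl
    · cases η; cases θ; exact Hom₂.arr_congr (Category.id_comp _).symm
  id_whiskerLeft η := by
    change Hom₂ _ _ at η
    cases η
    · rfl
    · exact Hom₂.arr_congr (by simp : _ = 𝟙 _ ≫ _ ≫ 𝟙 _)
  comp_whiskerLeft f g h h' η := by
    change Hom _ _ at f g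
    change Hom₂ _ _ at η
    cases f
    · cases g
      · cases η
        · rfl
        · exact Hom₂.arr_congr (by simp : _ = 𝟙 _ ≫ _ ≫ 𝟙 _)
      · cases η; exact Hom₂.arr_congr (by simp : 𝟙 _ = 𝟙 _ ≫ 𝟙 _ ≫ 𝟙 _)
    · cases g; cases η; exact Hom₂.arr_congr (by simp : 𝟙 _ = 𝟙 _ ≫ 𝟙 _ ≫ 𝟙 _)
  id_whiskerRight f g := by
    change Hom _ _ at f g
    cases f <;> cases g <;> rfl
  comp_whiskerRight η θ i := by
    change Hom _ _ at i
    change Hom₂ _ _ at η θ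
    cases η
    · cases θ
      cases i
      · rfl
      · exact Hom₂.arr_congr (Category.id_comp _).symm
    · cases θ; cases i; rfl
  whiskerRight_id η := by
    change Hom₂ _ _ at η
    cases η
    · rename_i a
      cases a <;> rfl
    · exact Hom₂.arr_congr (by simp : _ = 𝟙 _ ≫ _ ≫ 𝟙 _)
  whiskerRight_comp η g h := by
    change Hom _ _ at g h
    change Hom₂ _ _ at η
    cases η
    · cases g
      · cases h
        · rfl
        · exact Hom₂.arr_congr (by simp : 𝟙 _ = 𝟙 _ ≫ 𝟙 _ ≫ 𝟙 _)
      · cases h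
        exact Hom₂.arr_congr (by simp : 𝟙 _ = 𝟙 _ ≫ 𝟙 _ ≫ 𝟙 _)
    · cases g; cases h
      exact Hom₂.arr_congr (by simp : _ = 𝟙 _ ≫ _ ≫ 𝟙 _)
  whisker_assoc f _ _ η h := by
    change Hom _ _ at f h
    change Hom₂ _ _ at η
    cases f
    · cases η
      · cases h
        · rfl
        · exact Hom₂.arr_congr (by simp : 𝟙 _ = 𝟙 _ ≫ 𝟙 _ ≫ 𝟙 _)
      · cases h
        exact Hom₂.arr_congr (by simp : _ = 𝟙 _ ≫ _ ≫ 𝟙 _)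
    · cases η; cases h
      exact Hom₂.arr_congr (by simp : 𝟙 _ = 𝟙 _ ≫ 𝟙 _ ≫ 𝟙 _)
  whisker_exchange η θ := by
    change Hom₂ _ _ at η θ
    cases η
    · cases θ
      · rfl
      · exact Hom₂.arr_congr (by simp : _ ≫ 𝟙 _ = 𝟙 _ ≫ _)
    · cases θ
      exact Hom₂.arr_congr (by simp : 𝟙 _ ≫ _ = _ ≫ 𝟙 _)
  pentagon f g h i := by
    change Hom _ _ at f g h i
    cases f
    · cases g
      · cases h
        · cases i
          · rfl
          · exact Hom₂.arr_congr (by simp : 𝟙 _ ≫ 𝟙 _ ≫ 𝟙 _ = 𝟙 _ ≫ 𝟙 _)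
        · cases i
          exact Hom₂.arr_congr (by simp : 𝟙 _ ≫ 𝟙 _ ≫ 𝟙 _ = 𝟙 _ ≫ 𝟙 _)
      · cases h; cases i
        exact Hom₂.arr_congr (by simp : 𝟙 _ ≫ 𝟙 _ ≫ 𝟙 _ = 𝟙 _ ≫ 𝟙 _)
    · cases g; cases h; cases i
      exact Hom₂.arr_congr (by simp : 𝟙 _ ≫ 𝟙 _ ≫ 𝟙 _ = 𝟙 _ ≫ 𝟙 _)
  triangle f g := by
    change Hom _ _ at f g
    cases f
    · cases g
      · rfl
      · exact Hom₂.arr_congr (by simp : 𝟙 _ ≫ 𝟙 _ = 𝟙 _)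
    · cases g
      exact Hom₂.arr_congr (by simp : 𝟙 _ ≫ 𝟙 _ = 𝟙 _)

instance : Bicategory.Strict (Susp K) where
  id_comp _ := rfl
  comp_id := Hom.comp_id
  assoc := Hom.assoc

lemma isFiniteTwoCategory [Finite K] [∀ k l : K, Finite (k ⟶ l)] :
    IsFiniteTwoCategory (Susp K) := by
  refine ⟨?_, fun a b => ?_, fun a b f g => ?_⟩
  · refine Finite.of_surjective (fun b : Bool => bif b then src else tgt) ?_
    rintro (_ | _)
    · exact ⟨true, rfl⟩
    · exact ⟨false, rfl⟩
  · change Finite (Hom a b)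
    cases a <;> cases b
    · exact Finite.of_surjective (fun _ : Unit => Hom.id _) (by rintro (_ | _); exact ⟨(), rfl⟩)
    · exact Finite.of_surjective Hom.arr (by rintro (_ | k); exact ⟨k, rfl⟩)
    · exact Finite.of_surjective Empty.elim (by rintro ⟨⟩)
    · exact Finite.of_surjective (fun _ : Unit => Hom.id _) (by rintro (_ | _); exact ⟨(), rfl⟩)
  · change Hom a b at f g
    change Finite (Hom₂ f g)
    cases f
    · cases g
      exact Finite.of_surjective (fun _ : Unit => Hom₂.id _) (by rintro (_ | _); exact ⟨(), rfl⟩)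
    · cases g
      exact Finite.of_surjective Hom₂.arr (by rintro (_ | u); exact ⟨u, rfl⟩)

/-! ### `2`-functors on a suspension -/

section Functor

variable {C : Type u} [Bicategory.{w, v} C] [Bicategory.Strict C] {X Y : C}

/-- Unitors of a strict bicategory are `eqToHom`s. This and the next three lemmas are the cases of
compatibility with whiskering that occur for a `2`-functor on a suspension. -/
lemma eqToHom_comp_id_whiskerLeft {f g : X ⟶ Y} (η : f ⟶ g) (h : f = 𝟙 X ≫ f)
    (h' : 𝟙 X ≫ g = g) : η = eqToHom h ≫ 𝟙 X ◁ η ≫ eqToHom h' := by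
  simp [id_whiskerLeft, Bicategory.Strict.leftUnitor_eqToIso]

lemma eqToHom_comp_whiskerRight_id {f g : X ⟶ Y} (η : f ⟶ g) (h : f = f ≫ 𝟙 Y)
    (h' : g ≫ 𝟙 Y = g) : η = eqToHom h ≫ η ▷ 𝟙 Y ≫ eqToHom h' := by
  simp [whiskerRight_id, Bicategory.Strict.rightUnitor_eqToIso]

lemma eqToHom_comp_whiskerLeft_id_id (f : X ⟶ Y) (h : f = f ≫ 𝟙 Y) (h' : f ≫ 𝟙 Y = f) :
    𝟙 f = eqToHom h ≫ f ◁ 𝟙 (𝟙 Y) ≫ eqToHom h' := by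
  simp

lemma eqToHom_comp_id_id_whiskerRight (f : X ⟶ Y) (h : f = 𝟙 X ≫ f) (h' : 𝟙 X ≫ f = f) :
    𝟙 f = eqToHom h ≫ 𝟙 (𝟙 X) ▷ f ≫ eqToHom h' := by
  simp

variable (G : K ⥤ (X ⟶ Y))

/-- The action on objects of the `2`-functor given by `G`. -/
def functorObj (X Y : C) : Susp K → C
  | src => X
  | tgt => Y

/-- The action on arrows of the `2`-functor given by `G`. -/
def functorMap : {a b : Susp K} → Hom a b → (functorObj X Y a ⟶ functorObj X Y b)
  | _, _, .id _ => 𝟙 _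
  | _, _, .arr k => G.obj k

/-- The action on `2`-cells of the `2`-functor given by `G`. -/
def functorMap₂ : {a b : Susp K} → {f g : Hom a b} → Hom₂ f g → (functorMap G f ⟶ functorMap G g)
  | _, _, _, _, .id _ => 𝟙 _
  | _, _, _, _, .arr u => G.map u

lemma functorMap₂_refl {a b : Susp K} (f : Hom a b) :
    functorMap₂ G (.refl f) = 𝟙 (functorMap G f) := by
  cases f
  · rfl
  · exact G.map_id _

lemma functorMap_comp {a b c : Susp K} (f : Hom a b) (g : Hom b c) :
    functorMap G (f.comp g) = functorMap G f ≫ functorMap G g := by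
  cases f
  · exact (Bicategory.Strict.id_comp _).symm
  · cases g
    exact (Bicategory.Strict.comp_id _).symm

lemma functorMap₂_whiskerLeft {a b c : Susp K} (f : Hom a b) {g h : Hom b c} (η : Hom₂ g h) :
    functorMap₂ G (whiskerLeft f η) = eqToHom (functorMap_comp G f g) ≫
      functorMap G f ◁ functorMap₂ G η ≫ eqToHom (functorMap_comp G f h).symm := by
  cases f
  · exact eqToHom_comp_id_whiskerLeft _ _ _
  · cases η
    exact (G.map_id _).trans (eqToHom_comp_whiskerLeft_id_id _ _ _)

lemma functorMap₂_whiskerRight {a b c : Susp K} {f g : Hom a b} (η : Hom₂ f g) (h : Hom b c) :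
    functorMap₂ G (whiskerRight η h) = eqToHom (functorMap_comp G f h) ≫
      functorMap₂ G η ▷ functorMap G h ≫ eqToHom (functorMap_comp G g h).symm := by
  cases η
  · exact (functorMap₂_refl G h).trans (eqToHom_comp_id_id_whiskerRight _ _ _)
  · cases h
    exact eqToHom_comp_whiskerRight_id _ _ _

/-- The `2`-functor on the suspension of `K` given by a functor from `K` to a hom-category. -/
def functor : StrictPseudofunctor (Susp K) C :=
  StrictPseudofunctor.mk''
    { obj := functorObj X Y
      map := functorMap G
      map₂ := functorMap₂ G
      map₂_id := functorMap₂_refl G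
      map₂_comp := fun η θ => by
        change Hom₂ _ _ at η θ
        cases η
        · cases θ
          exact (Category.comp_id _).symm
        · cases θ
          exact G.map_comp _ _
      map_id := fun _ => rfl
      map_comp := functorMap_comp G
      map₂_whisker_left := functorMap₂_whiskerLeft G
      map₂_whisker_right := functorMap₂_whiskerRight G }

end Functor

/-! ### Pseudonatural transformations on a suspension -/

section Trans

variable {B : Type u₁} [Bicategory.{w₁, v₁} B] {C : Type u₂} [Bicategory.{w₂, v₂} C]

/-- When one factor is an identity, compatibility with composition is redundant: it follows from the
unit law and from naturality at the unitor. This and its mirror image cover every composable pair in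
a suspension. -/
lemma naturality_comp_id_left {F G : B ⥤ᵖ C} (app : ∀ a, F.obj a ⟶ G.obj a)
    (nat : ∀ {a b : B} (f : a ⟶ b), F.map f ≫ app b ≅ app a ≫ G.map f)
    (h₂ : ∀ {a b : B} {f g : a ⟶ b} (η : f ⟶ g),
      F.map₂ η ▷ app b ≫ (nat g).hom = (nat f).hom ≫ app a ◁ G.map₂ η)
    (h₁ : ∀ a : B, (nat (𝟙 a)).hom ≫ app a ◁ (G.mapId a).hom =
        (F.mapId a).hom ▷ app a ≫ (λ_ (app a)).hom ≫ (ρ_ (app a)).inv)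
    {a b : B} (g : a ⟶ b) :
    (nat (𝟙 a ≫ g)).hom ≫ app a ◁ (G.mapComp (𝟙 a) g).hom =
        (F.mapComp (𝟙 a) g).hom ▷ app b ≫ (α_ _ _ _).hom ≫ F.map (𝟙 a) ◁ (nat g).hom ≫
        (α_ _ _ _).inv ≫ (nat (𝟙 a)).hom ▷ G.map g ≫ (α_ _ _ _).hom := by
  -- The unit law determines the isomorphism at `𝟙 a`, and naturality at `λ_ g` the one at `𝟙 a ≫
  -- g`.
  have e₁ : (nat (𝟙 a)).hom = ((F.mapId a).hom ▷ app a ≫ (λ_ (app a)).hom ≫ (ρ_ (app a)).inv) ≫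
      app a ◁ (G.mapId a).inv := by
    rw [← h₁]; simp
  have e₂ : (nat (𝟙 a ≫ g)).hom = F.map₂ (λ_ g).hom ▷ app b ≫ (nat g).hom ≫
      app a ◁ G.map₂ (λ_ g).inv := by
    rw [← h₂, ← comp_whiskerRight_assoc, ← F.map₂_comp]; simp
  have e₃ : G.map₂ (λ_ g).inv ≫ (G.mapComp (𝟙 a) g).hom =
      (λ_ (G.map g)).inv ≫ (G.mapId a).inv ▷ G.map g := by
    rw [G.mapComp_id_left_hom, ← Category.assoc, ← G.map₂_comp]; simp
  -- The interchange law moves the unit constraint of `F` past the isomorphism at `g`.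
  have e₄ : F.map (𝟙 a) ◁ (nat g).hom ≫ (α_ _ _ _).inv ≫
      (F.mapId a).hom ▷ app a ▷ G.map g ≫ (α_ _ _ _).hom =
      (F.mapId a).hom ▷ (F.map g ≫ app b) ≫ 𝟙 _ ◁ (nat g).hom := by
    rw [associator_naturality_left, Iso.inv_hom_id_assoc, whisker_exchange]
  rw [e₁, e₂, F.mapComp_id_left_hom]
  simp only [Category.assoc, ← whiskerLeft_comp, e₃, comp_whiskerRight]
  simp [reassoc_of% e₄]

lemma naturality_comp_id_right {F G : B ⥤ᵖ C} (app : ∀ a, F.obj a ⟶ G.obj a)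
    (nat : ∀ {a b : B} (f : a ⟶ b), F.map f ≫ app b ≅ app a ≫ G.map f)
    (h₂ : ∀ {a b : B} {f g : a ⟶ b} (η : f ⟶ g),
      F.map₂ η ▷ app b ≫ (nat g).hom = (nat f).hom ≫ app a ◁ G.map₂ η)
    (h₁ : ∀ a : B, (nat (𝟙 a)).hom ≫ app a ◁ (G.mapId a).hom =
        (F.mapId a).hom ▷ app a ≫ (λ_ (app a)).hom ≫ (ρ_ (app a)).inv)
    {a b : B} (f : a ⟶ b) :
    (nat (f ≫ 𝟙 b)).hom ≫ app a ◁ (G.mapComp f (𝟙 b)).hom =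
        (F.mapComp f (𝟙 b)).hom ▷ app b ≫ (α_ _ _ _).hom ≫ F.map f ◁ (nat (𝟙 b)).hom ≫
        (α_ _ _ _).inv ≫ (nat f).hom ▷ G.map (𝟙 b) ≫ (α_ _ _ _).hom := by
  have e₁ : (nat (𝟙 b)).hom = ((F.mapId b).hom ▷ app b ≫ (λ_ (app b)).hom ≫ (ρ_ (app b)).inv) ≫
      app b ◁ (G.mapId b).inv := by
    rw [← h₁]; simp
  have e₂ : (nat (f ≫ 𝟙 b)).hom = F.map₂ (ρ_ f).hom ▷ app b ≫ (nat f).hom ≫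
      app a ◁ G.map₂ (ρ_ f).inv := by
    rw [← h₂, ← comp_whiskerRight_assoc, ← F.map₂_comp]; simp
  have e₃ : G.map₂ (ρ_ f).inv ≫ (G.mapComp f (𝟙 b)).hom =
      (ρ_ (G.map f)).inv ≫ G.map f ◁ (G.mapId b).inv := by
    rw [G.mapComp_id_right_hom, ← Category.assoc, ← G.map₂_comp]; simp
  have e₄ : F.map f ◁ app b ◁ (G.mapId b).inv ≫ (α_ _ _ _).inv ≫
      (nat f).hom ▷ G.map (𝟙 b) =
      (α_ _ _ _).inv ≫ (nat f).hom ▷ 𝟙 _ ≫ (app a ≫ G.map f) ◁ (G.mapId b).inv := by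
    rw [associator_inv_naturality_right_assoc, whisker_exchange]
  rw [e₁, e₂, F.mapComp_id_right_hom]
  simp only [Category.assoc, ← whiskerLeft_comp, e₃, comp_whiskerRight]
  simp [reassoc_of% e₄]

variable {F G : Susp K ⥤ᵖ C}

/-- The components of a transformation between pseudofunctors on a suspension. -/
def transApp (a : F.obj src ⟶ G.obj src) (b : F.obj tgt ⟶ G.obj tgt) :
    ∀ x : Susp K, F.obj x ⟶ G.obj x
  | src => a
  | tgt => b

variable {a : F.obj src ⟶ G.obj src} {b : F.obj tgt ⟶ G.obj tgt}

/-- The naturality isomorphism at an identity which is forced by the unit law. -/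
def idNaturality (F G : B ⥤ᵖ C) {x : B} (t : F.obj x ⟶ G.obj x) :
    F.map (𝟙 x) ≫ t ≅ t ≫ G.map (𝟙 x) :=
  whiskerRightIso (F.mapId x) t ≪≫ λ_ t ≪≫ (ρ_ t).symm ≪≫ whiskerLeftIso t (G.mapId x).symm

/-- The naturality isomorphisms of a transformation between pseudofunctors on a suspension. -/
def transNaturality (n : ∀ k : K, F.map (arr k) ≫ b ≅ a ≫ G.map (arr k)) :
    ∀ {x y : Susp K} (f : Hom x y), F.map f ≫ transApp a b y ≅ transApp a b x ≫ G.map f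
  | x, _, .id _ => idNaturality F G (transApp a b x)
  | _, _, .arr k => n k

/-- A transformation between pseudofunctors on the suspension of `K` is given by its two
components and isomorphisms natural in the objects of `K`. -/
def trans (n : ∀ k : K, F.map (arr k) ≫ b ≅ a ≫ G.map (arr k))
    (hn : ∀ {k l : K} (u : k ⟶ l),
      F.map₂ (arr₂ u) ▷ b ≫ (n l).hom = (n k).hom ≫ a ◁ G.map₂ (arr₂ u)) : F ⟶ G :=
  have h₁ : ∀ x : Susp K, (transNaturality n (Hom.id x)).hom ≫ transApp a b x ◁ (G.mapId x).hom =
      (F.mapId x).hom ▷ transApp a b x ≫ (λ_ (transApp a b x)).hom ≫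
        (ρ_ (transApp a b x)).inv := fun x => by
    change (idNaturality F G (transApp a b x)).hom ≫ _ = _
    simp [idNaturality]
  have h₂ : ∀ {x y : Susp K} {f g : x ⟶ y} (η : f ⟶ g),
      F.map₂ η ▷ transApp a b y ≫ (transNaturality n g).hom =
        (transNaturality n f).hom ≫ transApp a b x ◁ G.map₂ η := fun {x y f g} η => by
    change Hom₂ _ _ at η
    cases η
    · have hF := F.map₂_id (𝟙 x)
      have hG := G.map₂_id (𝟙 x)
      change F.map₂ (𝟙 (𝟙 x)) ▷ transApp a b x ≫ (transNaturality n (𝟙 x)).hom =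
        (transNaturality n (𝟙 x)).hom ≫ transApp a b x ◁ G.map₂ (𝟙 (𝟙 x))
      rw [hF, hG]
      simp
    · exact hn _
  { app := transApp a b
    naturality := transNaturality n
    naturality_naturality := h₂
    naturality_id := h₁
    naturality_comp := fun f g => by
      change Hom _ _ at f g
      -- Of two composable arrows one is an identity.
      cases f
      · exact naturality_comp_id_left (transApp a b) (transNaturality n) h₂ h₁ g
      · cases g
        exact naturality_comp_id_right (transApp a b) (transNaturality n) h₂ h₁ _ }

end Trans

end Susp

end Suspension

/-! ### Weighted bilimits over a suspension -/

section SuspensionCones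

/-- The objects of a category `Q`, as functors from the terminal category to `Q`. -/
def point (Q : Type v) [Category.{v} Q] : Q ⥤ (Cat.of (Discrete PUnit.{v + 1}) ⟶ Cat.of Q) where
  obj q := (Functor.fromPUnit q).toCatHom
  map u := NatTrans.toCatHom₂ (Discrete.natTrans fun _ => u)

variable {K : Type} [Category.{0} K] {V : Type v} [Category.{v} V] (G : K ⥤ V)

/-- The weight on the suspension of `K` given by a functor `K ⥤ V`. -/
abbrev suspWeight : StrictPseudofunctor (Susp K) Cat.{v, v} :=
  Susp.functor (G ⋙ point V)

lemma isFiniteWeight_suspWeight [Finite K] [∀ k l : K, Finite (k ⟶ l)] [Finite V]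
    [∀ x y : V, Finite (x ⟶ y)] : IsFiniteWeight (suspWeight G) := by
  refine ⟨Susp.isFiniteTwoCategory, ?_⟩
  rintro (_ | _)
  · exact ⟨inferInstanceAs (Finite (Discrete PUnit)),
      fun x y => inferInstanceAs (Finite (ULift (PLift (x.as = y.as))))⟩
  · exact ⟨inferInstanceAs (Finite V), inferInstanceAs (∀ x y : V, Finite (x ⟶ y))⟩

/-- The pseudocone with vertex `T` given by `x : T ⟶ FX`, a functor `t : V ⥤ (T ⟶ FY)`, and
isomorphisms `t (G k) ≅ x ≫ F k` natural in `k`. -/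
def suspCone {B : Type u} [Bicategory.{v, v} B] (F : Susp K ⥤ᵖ B) {T : B}
    (x : T ⟶ F.obj .src) (t : V ⥤ (T ⟶ F.obj .tgt))
    (e : ∀ k, t.obj (G.obj k) ≅ x ≫ F.map (Susp.arr k))
    (he : ∀ {k l : K} (u : k ⟶ l),
      t.map (G.map u) ≫ (e l).hom = (e k).hom ≫ x ◁ F.map₂ (Susp.arr₂ u)) :
    WCone (suspWeight G).toPseudofunctor F T :=
  Susp.trans (F := (suspWeight G).toPseudofunctor) (G := F.comp (rep T))
    (a := (Functor.fromPUnit x).toCatHom) (b := t.toCatHom)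
    (fun k => Cat.Hom.isoMk (Discrete.natIso (F := Functor.fromPUnit (G.obj k) ⋙ t)
      (G := Functor.fromPUnit x ⋙ postcomp T (F.map (Susp.arr k))) fun _ => e k))
    (fun {k l} u => by
      ext
      exact he u)

/-- If `P` is left exact, `x : T ⟶ PX` and `t : V ⥤ (T ⟶ PY)` satisfy
`t (G k) ≅ x ≫ P (H k)` naturally in `k`, then these data come from similar data
`h : L ⟶ X`, `s : V ⥤ (L ⟶ Y)`, `s (G k) ≅ h ≫ H k` by composition with some `z : T ⟶ PL`. -/
theorem IsLeftExact.exists_suspension {A : Type u} [Bicategory.{v, v} A] [Bicategory.Strict A]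
    (hA : HasFiniteBilimits A) {P : StrictPseudofunctor A Cat.{v, v}} (hP : IsLeftExact P)
    [Finite K] [∀ k l : K, Finite (k ⟶ l)] [Finite V] [∀ x y : V, Finite (x ⟶ y)]
    {X Y : A} (H : K ⥤ (X ⟶ Y)) {T : Cat.{v, v}} (x : T ⟶ P.obj X) (t : V ⥤ (T ⟶ P.obj Y))
    (e : ∀ k, t.obj (G.obj k) ≅ x ≫ P.map (H.obj k))
    (he : ∀ {k l : K} (u : k ⟶ l),
      t.map (G.map u) ≫ (e l).hom = (e k).hom ≫ x ◁ P.map₂ (H.map u)) :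
    ∃ (L : A) (h : L ⟶ X) (s : V ⥤ (L ⟶ Y)) (σ : ∀ k, s.obj (G.obj k) ≅ h ≫ H.obj k)
      (z : T ⟶ P.obj L) (a : z ≫ P.map h ≅ x) (b : ∀ y : V, z ≫ P.map (s.obj y) ≅ t.obj y),
      (∀ {k l : K} (u : k ⟶ l), s.map (G.map u) ≫ (σ l).hom = (σ k).hom ≫ h ◁ H.map u) ∧
      (∀ {y y' : V} (w : y ⟶ y'),
        z ◁ P.map₂ (s.map w) ≫ (b y').hom = (b y).hom ≫ t.map w) ∧
      ∀ k, (b (G.obj k)).hom ≫ (e k).hom =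
        (z ◁ (P.map₂ (σ k).hom ≫ (P.mapComp h (H.obj k)).hom) ≫ (α_ _ _ _).inv) ≫
          a.hom ▷ P.map (H.obj k) := by
  obtain ⟨L, ξ, z, ⟨i⟩⟩ := hP.exists_cone hA (suspWeight G) (Susp.functor H)
    (isFiniteWeight_suspWeight G)
    (suspCone G ((Susp.functor H).toPseudofunctor.comp P.toPseudofunctor) x t e he)
  let p : Discrete PUnit.{v + 1} := ⟨⟨⟩⟩
  refine ⟨L, (ξ.leg Susp.src).obj p, ξ.leg Susp.tgt,
    fun k => ξ.legIso (Susp.arr k) p, z, (WCone.isoLeg i Susp.src).app p,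
    fun y => (WCone.isoLeg i Susp.tgt).app y, ?_, ?_, ?_⟩
  · intro k l u
    exact ξ.legIso_naturality₂ (Susp.arr₂ u) p
  · intro y y' w
    exact (WCone.isoLeg i Susp.tgt).hom.naturality w
  · intro k
    -- The modification axiom of `i` at the arrow `k`; `h₁` and `h₂` unfold the structural
    -- isomorphism of `z^*(Pξ)` there.
    have h := WCone.isoLeg_naturality i (Susp.arr k) p
    have h₁ := WCone.pullback_legIso_hom (ξ.image P.toPseudofunctor) z (Susp.arr k) p
    have h₂ := WCone.image_legIso_hom ξ P.toPseudofunctor (Susp.arr k) p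
    exact h.trans (congrArg (fun u => u ≫ _)
      (h₁.trans (congrArg (fun u => z ◁ u ≫ (α_ z _ _).inv) h₂)))

/-- The special case of `IsLeftExact.exists_suspension` in which `T` is the terminal category, in
terms of objects and arrows of the categories `PX` and `PY`. -/
theorem IsLeftExact.exists_fiber {A : Type u} [Bicategory.{v, v} A] [Bicategory.Strict A]
    (hA : HasFiniteBilimits A) {P : StrictPseudofunctor A Cat.{v, v}} (hP : IsLeftExact P)
    [Finite K] [∀ k l : K, Finite (k ⟶ l)] [Finite V] [∀ x y : V, Finite (x ⟶ y)]
    {X Y : A} (H : K ⥤ (X ⟶ Y)) (x : P.obj X) (t : V ⥤ P.obj Y)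
    (e : ∀ k, t.obj (G.obj k) ≅ (P.map (H.obj k)).toFunctor.obj x)
    (he : ∀ {k l : K} (u : k ⟶ l),
      t.map (G.map u) ≫ (e l).hom = (e k).hom ≫ (P.map₂ (H.map u)).toNatTrans.app x) :
    ∃ (L : A) (h : L ⟶ X) (s : V ⥤ (L ⟶ Y)) (σ : ∀ k, s.obj (G.obj k) ≅ h ≫ H.obj k)
      (z : P.obj L) (a : (P.map h).toFunctor.obj z ≅ x)
      (b : ∀ y : V, (P.map (s.obj y)).toFunctor.obj z ≅ t.obj y),
      (∀ {k l : K} (u : k ⟶ l), s.map (G.map u) ≫ (σ l).hom = (σ k).hom ≫ h ◁ H.map u) ∧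
      (∀ {y y' : V} (w : y ⟶ y'),
        (P.map₂ (s.map w)).toNatTrans.app z ≫ (b y').hom = (b y).hom ≫ t.map w) ∧
      ∀ k, (b (G.obj k)).hom ≫ (e k).hom = (P.map₂ (σ k).hom).toNatTrans.app z ≫
        (P.mapComp h (H.obj k)).hom.toNatTrans.app z ≫
          (P.map (H.obj k)).toFunctor.map a.hom := by
  let p : Discrete PUnit.{v + 1} := ⟨⟨⟩⟩
  obtain ⟨L, h, s, σ, z, a, b, h₁, h₂, h₃⟩ := hP.exists_suspension G hA H
    ((point (P.obj X)).obj x) (t ⋙ point (P.obj Y))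
    (fun k => Cat.Hom.isoMk (Discrete.natIso (F := Functor.fromPUnit (t.obj (G.obj k)))
      (G := Functor.fromPUnit x ⋙ (P.map (H.obj k)).toFunctor) fun _ => e k))
    (fun {k l} u => by
      ext
      exact he u)
  refine ⟨L, h, s, σ, z.toFunctor.obj p, (Cat.Hom.toNatIso a).app p,
    fun y => (Cat.Hom.toNatIso (b y)).app p, h₁, fun w => ?_, fun k => ?_⟩
  · exact congrArg (fun α => α.toNatTrans.app p) (h₂ w)
  · have h := congrArg (fun α => α.toNatTrans.app p) (h₃ k)
    refine h.trans ?_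
    -- The identity is the component of an associator of `Cat`.
    have h' : ∀ {Q : Type v} [Category.{v} Q] {q₁ q₂ q₃ q₄ : Q} (f₁ : q₁ ⟶ q₂) (f₂ : q₂ ⟶ q₃)
      (f₃ : q₃ ⟶ q₄), ((f₁ ≫ f₂) ≫ 𝟙 _) ≫ f₃ = f₁ ≫ f₂ ≫ f₃ := by simp
    exact h' _ _ _

end SuspensionCones

/-! ### The biterminal object -/

section Empty

/-- The `2`-functor on the empty `2`-category. -/
def emptyFunctor (C : Type u) [Bicategory.{w, v} C] [Bicategory.Strict C] :
    StrictPseudofunctor (LocallyDiscrete (Discrete PEmpty.{1})) C :=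
  StrictPseudofunctor.mk''
    { obj x := x.as.as.elim
      map {x} := x.as.as.elim
      map₂ {x} := x.as.as.elim
      map₂_id {x} := x.as.as.elim
      map₂_comp {x} := x.as.as.elim
      map_id x := x.as.as.elim
      map_comp {x} := x.as.as.elim
      map₂_whisker_left {x} := x.as.as.elim
      map₂_whisker_right {x} := x.as.as.elim }

lemma isFiniteWeight_empty (W : StrictPseudofunctor (LocallyDiscrete (Discrete PEmpty.{1}))
    Cat.{w, v}) : IsFiniteWeight W :=
  ⟨⟨Finite.of_injective (fun x => x.as.as) fun x => x.as.as.elim, fun x => x.as.as.elim,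
    fun x => x.as.as.elim⟩, fun x => x.as.as.elim⟩

/-- The empty diagram has a pseudocone with vertex the terminal category; lifting it gives an
element of `PL` for `L` biterminal. -/
theorem IsLeftExact.nonempty_el {A : Type u} [Bicategory.{v, v} A] [Bicategory.Strict A]
    (hA : HasFiniteBilimits A) {P : StrictPseudofunctor A Cat.{v, v}} (hP : IsLeftExact P) :
    Nonempty (El P.toPseudofunctor) := by
  obtain ⟨L, -, z, -⟩ := hP.exists_cone hA (emptyFunctor _) (emptyFunctor _)
    (isFiniteWeight_empty _) (T := Cat.of (Discrete PUnit.{v + 1}))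
    { app x := x.as.as.elim
      naturality {x} := x.as.as.elim
      naturality_naturality {x} := x.as.as.elim
      naturality_id x := x.as.as.elim
      naturality_comp {x} := x.as.as.elim }
  exact ⟨⟨L, z.toFunctor.obj ⟨⟨⟩⟩⟩⟩

end Empty


/-! ### The conditions for `σ`-cofilteredness -/

section Cofiltered

variable {A : Type u} [Bicategory.{v, v} A] [Bicategory.Strict A]

theorem IsLeftExact.exists_cart_pair (hA : HasFiniteBilimits A)
    {P : StrictPseudofunctor A Cat.{v, v}} (hP : IsLeftExact P) (X Y : El P.toPseudofunctor) :
    ∃ (E : El P.toPseudofunctor) (f : E ⟶ X) (g : E ⟶ Y),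
      (El.cart P.toPseudofunctor).mem f ∧ (El.cart P.toPseudofunctor).mem g := by
  -- With `K` empty and `V` terminal, a pseudocone is a pair of arrows to `X` and `Y`, so `L` is
  -- their product.
  obtain ⟨L, h, s, -, z, a, b, -⟩ := hP.exists_fiber (K := Discrete PEmpty.{1})
    (V := Discrete PUnit.{v + 1}) (Functor.empty _) hA (X := X.base) (Y := Y.base)
    (Functor.empty _) X.fiber (Functor.fromPUnit Y.fiber) (fun k => k.as.elim)
    (fun {k} => k.as.elim)
  exact ⟨⟨L, z⟩, ⟨h, a.hom⟩, ⟨s.obj ⟨⟨⟩⟩, (b ⟨⟨⟩⟩).hom⟩, a.isIso_hom, (b ⟨⟨⟩⟩).isIso_hom⟩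

/-- Arrows `f`, `g` of `El_P` admit a `2`-cell `h ≫ f ⟶ h ≫ g` with `h` cocartesian if they do so
in `PY`; the `2`-cell is invertible if it comes from an invertible arrow of `V`. -/
theorem IsLeftExact.exists_cart_comp_hom (hA : HasFiniteBilimits A)
    {P : StrictPseudofunctor A Cat.{v, v}} (hP : IsLeftExact P) {X Y : El P.toPseudofunctor}
    (f g : X ⟶ Y) {V : Type v} [Category.{v} V] [Finite V] [∀ x y : V, Finite (x ⟶ y)]
    (t : V ⥤ P.obj Y.base) {v₀ v₁ : V} (c : v₀ ⟶ v₁)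
    (e₀ : t.obj v₀ ≅ (P.map (El.Hom.base f)).toFunctor.obj X.fiber)
    (e₁ : t.obj v₁ ≅ (P.map (El.Hom.base g)).toFunctor.obj X.fiber)
    (w : t.map c ≫ e₁.hom ≫ El.Hom.fiber g = e₀.hom ≫ El.Hom.fiber f) :
    ∃ (E : El P.toPseudofunctor) (h : E ⟶ X) (α : h ≫ f ⟶ h ≫ g),
      (El.cart P.toPseudofunctor).mem h ∧ (IsIso c → IsIso α) := by
  -- With `K` two points, sent to `v₀, v₁` in `V` and to `f, g` in `A`, a pseudocone is an `h` with
  -- a `V`-shaped diagram through `h ≫ f` and `h ≫ g`.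
  obtain ⟨L, h, s, σ, z, a, b, -, h₂, h₃⟩ := hP.exists_fiber (K := Discrete Bool)
    (Discrete.functor fun i => bif i then v₁ else v₀) hA
    (Discrete.functor fun i => bif i then El.Hom.base g else El.Hom.base f) X.fiber t
    (fun ⟨i⟩ => match i with
      | true => e₁
      | false => e₀)
    (by
      rintro ⟨k⟩ ⟨l⟩ ⟨⟨u⟩⟩
      dsimp at u
      subst u
      cases k <;> simp)
  let σ₀ : s.obj v₀ ≅ h ≫ El.Hom.base f := σ ⟨false⟩
  let σ₁ : s.obj v₁ ≅ h ≫ El.Hom.base g := σ ⟨true⟩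
  have k₀ : (b v₀).hom ≫ e₀.hom = (P.map₂ σ₀.hom).toNatTrans.app z ≫
      (P.mapComp h (El.Hom.base f)).hom.toNatTrans.app z ≫
        (P.map (El.Hom.base f)).toFunctor.map a.hom := h₃ ⟨false⟩
  have k₁ : (b v₁).hom ≫ e₁.hom = (P.map₂ σ₁.hom).toNatTrans.app z ≫
      (P.mapComp h (El.Hom.base g)).hom.toNatTrans.app z ≫
        (P.map (El.Hom.base g)).toFunctor.map a.hom := h₃ ⟨true⟩
  let E : El P.toPseudofunctor := ⟨L, z⟩
  let h' : E ⟶ X := ⟨h, a.hom⟩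
  -- The candidate is `h ≫ f ≅ s v₀ ⟶ s v₁ ≅ h ≫ g`. Transported to `PY` along `b`, its condition
  -- for being a `2`-cell of `El_P` becomes `w`.
  have hα : (P.map₂ (σ₀.inv ≫ s.map c ≫ σ₁.hom)).toNatTrans.app z ≫ El.Hom.fiber (h' ≫ g) =
      El.Hom.fiber (h' ≫ f) := by
    have k₂ := h₂ c
    have k₃ : (P.map₂ σ₀.inv).toNatTrans.app z ≫ (P.map₂ σ₀.hom).toNatTrans.app z = 𝟙 _ := by
      rw [← Cat.Hom₂.comp_app, ← P.map₂_comp]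
      simp
    rw [P.map₂_comp, P.map₂_comp, Cat.Hom₂.comp_app, Cat.Hom₂.comp_app]
    calc
      _ = (P.map₂ σ₀.inv).toNatTrans.app z ≫ (P.map₂ (s.map c)).toNatTrans.app z ≫
          ((P.map₂ σ₁.hom).toNatTrans.app z ≫
            (P.mapComp h (El.Hom.base g)).hom.toNatTrans.app z ≫
              (P.map (El.Hom.base g)).toFunctor.map a.hom) ≫ El.Hom.fiber g := by
        simp only [Category.assoc]
        rfl
      _ = (P.map₂ σ₀.inv).toNatTrans.app z ≫ ((b v₀).hom ≫ e₀.hom) ≫ El.Hom.fiber f := by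
        rw [← k₁, Category.assoc, reassoc_of% k₂, w, Category.assoc]
      _ = _ := by
        rw [k₀]
        simp only [Category.assoc, reassoc_of% k₃]
        rfl
  refine ⟨E, h', El.Hom₂.mk (σ₀.inv ≫ s.map c ≫ σ₁.hom) hα, a.isIso_hom, fun _ => ?_⟩
  exact (El.isoMk (P := P.toPseudofunctor) (f := h' ≫ f) (g := h' ≫ g)
    (σ₀.symm ≪≫ asIso (s.map c) ≪≫ σ₁) hα).isIso_hom

/-- The walking arrow, as a preorder. -/
abbrev Arr : Type v := ULift.{v} (Fin 2)

/-- The functor on the walking arrow given by an arrow. -/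
def arrFunctor {Q : Type v} [Category.{v} Q] {q₀ q₁ : Q} (φ : q₀ ⟶ q₁) : Arr.{v} ⥤ Q :=
  Monotone.functor (f := fun i : Arr.{v} => i.down) (fun _ _ h => h) ⋙ ComposableArrows.mk₁ φ

/-- The cases need different weights: the arrow of the walking arrow is not invertible, so the
inserter alone cannot give an invertible `2`-cell. -/
theorem IsLeftExact.exists_cart_comp (hA : HasFiniteBilimits A)
    {P : StrictPseudofunctor A Cat.{v, v}} (hP : IsLeftExact P) {X Y : El P.toPseudofunctor}
    (f g : X ⟶ Y) (hg : (El.cart P.toPseudofunctor).mem g) :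
    ∃ (E : El P.toPseudofunctor) (h : E ⟶ X) (α : h ≫ f ⟶ h ≫ g),
      (El.cart P.toPseudofunctor).mem h ∧
        ((El.cart P.toPseudofunctor).mem f → IsIso α) := by
  have : IsIso (El.Hom.fiber g) := hg
  by_cases hf : (El.cart P.toPseudofunctor).mem f
  -- Iso-inserter: `V` is terminal, and `φ` followed by `ψ⁻¹` identifies `Pf(x)` with `Pg(x)`.
  · have : IsIso (El.Hom.fiber f) := hf
    obtain ⟨E, h, α, hh, hα⟩ := hP.exists_cart_comp_hom hA f g
      (Functor.fromPUnit.{v} ((P.map (El.Hom.base f)).toFunctor.obj X.fiber)) (𝟙 ⟨⟨⟩⟩)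
      (Iso.refl _) (asIso (El.Hom.fiber f) ≪≫ (asIso (El.Hom.fiber g)).symm) (by simp)
    exact ⟨E, h, α, hh, fun _ => hα inferInstance⟩
  -- Inserter: `V` is the walking arrow, sent to `φ` followed by `ψ⁻¹`.
  · obtain ⟨E, h, α, hh, -⟩ := hP.exists_cart_comp_hom hA f g
      (arrFunctor (El.Hom.fiber f ≫ inv (El.Hom.fiber g)))
      (v₀ := ⟨0⟩) (v₁ := ⟨1⟩) (homOfLE (by simp)) (Iso.refl _) (Iso.refl _) (by
        change (El.Hom.fiber f ≫ inv (El.Hom.fiber g)) ≫ 𝟙 _ ≫ _ = 𝟙 _ ≫ _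
        simp)
    exact ⟨E, h, α, hh, fun h => (hf h).elim⟩

theorem IsLeftExact.exists_cart_whiskerLeft_eq (hA : HasFiniteBilimits A)
    {P : StrictPseudofunctor A Cat.{v, v}} (hP : IsLeftExact P) {X Y : El P.toPseudofunctor}
    {f g : X ⟶ Y} (α β : f ⟶ g) (hg : (El.cart P.toPseudofunctor).mem g) :
    ∃ (E : El P.toPseudofunctor) (h : E ⟶ X),
      (El.cart P.toPseudofunctor).mem h ∧ h ◁ α = h ◁ β := by
  have : IsIso (El.Hom.fiber g) := hg
  -- Both components become `φ` after composition with the invertible `ψ`.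
  have hαβ : (P.map₂ (El.Hom₂.base α)).toNatTrans.app X.fiber =
      (P.map₂ (El.Hom₂.base β)).toNatTrans.app X.fiber := by
    rw [← cancel_mono (El.Hom.fiber g), α.w, β.w]
  let c : (⟨0⟩ : Arr.{v}) ⟶ ⟨1⟩ := homOfLE (by simp)
  -- The equifier: both arrows of the parallel pair go to the single arrow `c` of `V`, so `s c`
  -- corresponds under `σ` to `h ◁ α` and to `h ◁ β`.
  obtain ⟨L, h, s, σ, z, a, b, h₁, -⟩ := hP.exists_fiber
    (K := Limits.WalkingParallelPair) (Limits.parallelPair c c) hA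
    (Limits.parallelPair (El.Hom₂.base α) (El.Hom₂.base β)) X.fiber
    (arrFunctor ((P.map₂ (El.Hom₂.base α)).toNatTrans.app X.fiber))
    (fun k => match k with
      | .zero => Iso.refl _
      | .one => Iso.refl _)
    (by
      rintro k l (_ | _ | _)
      · exact (Category.comp_id _).trans (Category.id_comp _).symm
      · exact (Category.comp_id _).trans (hαβ.trans (Category.id_comp _).symm)
      · simp)
  refine ⟨⟨L, z⟩, ⟨h, a.hom⟩, a.isIso_hom, El.hom₂_ext ?_⟩
  have kα := h₁ Limits.WalkingParallelPairHom.left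
  have kβ := h₁ Limits.WalkingParallelPairHom.right
  exact (cancel_epi (σ .zero).hom).1 (kα.symm.trans kβ)

end Cofiltered

end SigmaLim

theorem mainTheorem6 {A : Type u} [Bicategory.{v, v} A] [Bicategory.Strict A]
    (hA : SigmaLim.HasFiniteBilimits A) (P : StrictPseudofunctor A Cat.{v, v})
    (hP : SigmaLim.IsLeftExact P) :
    SigmaLim.IsSigmaCofiltered (SigmaLim.El P.toPseudofunctor)
      (SigmaLim.El.cart P.toPseudofunctor) where
  nonempty := (hP.nonempty_el hA).map op
  F0 X Y := by
    obtain ⟨E, f, g, hf, hg⟩ := hP.exists_cart_pair hA X.unop Y.unop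
    exact ⟨op E, f.op, g.op, hf, hg⟩
  F1 f g hg := by
    obtain ⟨E, h, α, hh, hα⟩ := hP.exists_cart_comp hA f.unop g.unop hg
    refine ⟨op E, h.op, Bicategory.Opposite.op2 α, hh, fun hf => ?_⟩
    have := hα hf
    -- Reversing `1`-cells acts functorially on hom-categories, hence preserves invertibility of
    -- `2`-cells.
    exact inferInstanceAs (IsIso ((Bicategory.Opposite.opFunctor _ _).map α))
  F2 α β hg := by
    obtain ⟨E, h, hh, e⟩ := hP.exists_cart_whiskerLeft_eq hA α.unop2 β.unop2 hg
    exact ⟨op E, h.op, hh, congrArg Bicategory.Opposite.op2 e⟩
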